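/- For a finite simple graph $G$ with adjacency matrix $A(G)$ and diagonal degree matrix $D(G)$, put $A_\alpha(G)=\alpha D(G)+(1-\alpha)A(G)$, and let $\rho(A_\alpha(G))$ denote its spectral radius (the $A_\alpha$-spectral radius of $G$). Let $\pi=(d_0,d_1,\ldots,d_{n-1})$ be a nonincreasing sequence that is the degree sequence of some tree. Define a graph $\mathcal T^*_\pi$ on vertices $0,1,\ldots,n-1$ by breadth-first construction: let $c_0=d_0$ and $c_i=d_i-1$ for $i\ge 1$; for each $i$, join $i$ to its children, which are the $c_i$ vertices $k$ with $$1+\sum_{j<i}c_j\;\le\; k\;<\;1+\sum_{j\le i}c_j .$$ (So vertex $0$ is the root, layers are filled one after another from left to right, and the children of $0,1,2,\ldots$ are numbered consecutively from $1$.) **Theorem 1.1.** Let $0\le\alpha<1$. Then $\mathcal T^*_\pi$ is a tree with degree sequence $\pi$, and every tree $T$ with degree sequence $\pi$ satisfies $$\rho(A_\alpha(T))\le\rho(A_\alpha(\mathcal T^*_\pi)),$$ with equality if and only if $T$ is isomorphic to $\mathcal T^*_\pi$. -/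

import Mathlib

open scoped ENNReal

/-- The finite graph `G` has degree sequence `d = (d₀, …, d_{n-1})`: its vertices can be numbered
`0, …, n-1` so that the `i`-th vertex has degree `d i`. -/
def HasDegreeSequence {n : ℕ} {V : Type*} [Fintype V] (G : SimpleGraph V) [DecidableRel G.Adj]
    (d : Fin n → ℕ) : Prop :=
  ∃ e : V ≃ Fin n, ∀ v, G.degree v = d (e v)

/-- `d` is the degree sequence of some tree. -/
def IsTreeDegreeSequence {n : ℕ} (d : Fin n → ℕ) : Prop :=
  ∃ (G : SimpleGraph (Fin n)) (_ : DecidableRel G.Adj), G.IsTree ∧ HasDegreeSequence G d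

/-- The matrix `A_α(G) = α D(G) + (1 - α) A(G)`. -/
def aAlphaMatrix {V : Type*} [Fintype V] [DecidableEq V] (α : ℝ) (G : SimpleGraph V)
    [DecidableRel G.Adj] : Matrix V V ℝ :=
  α • G.degMatrix ℝ + (1 - α) • G.adjMatrix ℝ

/-- The `A_α`-spectral radius of `G`: the supremum of `|μ|` over the spectrum of `A_α(G)`.
The matrix is real symmetric, so its spectrum is real, finite, and consists of its eigenvalues. -/
noncomputable def aAlphaSpectralRadius {V : Type*} [Fintype V] [DecidableEq V] (α : ℝ)
    (G : SimpleGraph V) [DecidableRel G.Adj] : ℝ≥0∞ :=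
  spectralRadius ℝ (aAlphaMatrix α G)

/-- The number of children of vertex `i` in the breadth-first tree: `d₀` for the root `0`, and
`d i - 1` for every other vertex (one of its neighbours is its parent). -/
def bfsNumChildren {n : ℕ} (d : Fin n → ℕ) (i : Fin n) : ℕ :=
  if (i : ℕ) = 0 then d i else d i - 1

/-- The number of the first child of `i`: vertex `0` is the root, and the children of
`0, 1, 2, …` are numbered consecutively, parent after parent, starting from `1`. -/
def bfsFirstChild {n : ℕ} (d : Fin n → ℕ) (i : Fin n) : ℕ :=
  1 + ∑ j ∈ Finset.univ.filter (fun j : Fin n => j < i), bfsNumChildren d j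

/-- `k` is one of the children of `i`, which occupy the block of `bfsNumChildren d i` consecutive
numbers beginning with `bfsFirstChild d i`. -/
def IsBFSChild {n : ℕ} (d : Fin n → ℕ) (i k : Fin n) : Prop :=
  bfsFirstChild d i ≤ (k : ℕ) ∧ (k : ℕ) < bfsFirstChild d i + bfsNumChildren d i

instance {n : ℕ} (d : Fin n → ℕ) : DecidableRel (IsBFSChild d) :=
  fun i k => inferInstanceAs
    (Decidable (bfsFirstChild d i ≤ (k : ℕ) ∧ (k : ℕ) < bfsFirstChild d i + bfsNumChildren d i))

/-- The tree `T*_π` of a nonincreasing tree degree sequence `π = d`, built layer by layer. Vertices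
are numbered in the order of construction (layer after layer, inside a layer from left to right):
if layer `t ≥ 1` has `s_t` vertices `v_{t,1}, …, v_{t,s_t}`, then `v_{t,r}` is the vertex
`s_1 + ⋯ + s_{t-1} + r` of `Fin n`, and the root is `0`. Vertex `i` is to have degree `d i`, so it is
joined to the next `d i - 1` (for the root: `d 0`) vertices not yet used. -/
def bfsTree {n : ℕ} (d : Fin n → ℕ) : SimpleGraph (Fin n) where
  Adj i k := i ≠ k ∧ (IsBFSChild d i k ∨ IsBFSChild d k i)
  symm := ⟨fun _ _ h => ⟨h.1.symm, h.2.symm⟩⟩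
  loopless := ⟨fun _ h => h.1 rfl⟩

instance {n : ℕ} (d : Fin n → ℕ) : DecidableRel (bfsTree d).Adj :=
  fun i k => inferInstanceAs (Decidable (i ≠ k ∧ (IsBFSChild d i k ∨ IsBFSChild d k i)))

open Matrix in
/-- For an entrywise nonnegative matrix, passing to absolute values increases the quadratic form. -/
theorem abs_dotProduct_mulVec_le {V : Type*} [Fintype V] {M : Matrix V V ℝ}
    (hM : ∀ i j, 0 ≤ M i j) (z : V → ℝ) :
    |z ⬝ᵥ M *ᵥ z| ≤ (fun v => |z v|) ⬝ᵥ M *ᵥ (fun v => |z v|) := by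
  simp only [dotProduct, mulVec]
  refine (Finset.abs_sum_le_sum_abs _ _).trans (Finset.sum_le_sum fun i _ => ?_)
  rw [abs_mul]
  refine mul_le_mul_of_nonneg_left ?_ (abs_nonneg _)
  refine (Finset.abs_sum_le_sum_abs _ _).trans (Finset.sum_le_sum fun j _ => ?_)
  rw [abs_mul, abs_of_nonneg (hM i j)]

open Matrix in
/-- The quadratic form of a real matrix attains its maximal Rayleigh quotient. -/
theorem exists_rayleigh_max {V : Type*} [Fintype V] [Nonempty V] (M : Matrix V V ℝ) :
    ∃ (ρ : ℝ) (z : V → ℝ), z ⬝ᵥ z = 1 ∧ z ⬝ᵥ M *ᵥ z = ρ ∧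
      ∀ w : V → ℝ, w ⬝ᵥ M *ᵥ w ≤ ρ * (w ⬝ᵥ w) := by
  classical
  have hc : IsCompact {z : V → ℝ | z ⬝ᵥ z = 1} := by
    refine (isCompact_Icc (a := fun _ : V => (-1 : ℝ)) (b := fun _ => 1)).of_isClosed_subset
      (isClosed_eq (by simp only [dotProduct]; fun_prop) continuous_const) ?_
    intro z hz
    have hz' : ∑ v, z v * z v = 1 := hz
    have h1 : ∀ v, |z v| ≤ 1 := by
      intro v
      have := Finset.single_le_sum (f := fun v => z v * z v) (s := Finset.univ)
        (fun i _ => mul_self_nonneg (z i)) (Finset.mem_univ v)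
      simp only [hz'] at this
      rw [← sq] at this
      exact (sq_le_one_iff_abs_le_one _).1 this
    exact ⟨fun v => (abs_le.1 (h1 v)).1, fun v => (abs_le.1 (h1 v)).2⟩
  have hne : {z : V → ℝ | z ⬝ᵥ z = 1}.Nonempty := by
    obtain ⟨v⟩ := ‹Nonempty V›
    exact ⟨Pi.single v 1, by simp⟩
  obtain ⟨z, hz, hmax⟩ := hc.exists_isMaxOn hne
    (f := fun z => z ⬝ᵥ M *ᵥ z) (by simp only [dotProduct, mulVec]; fun_prop)
  refine ⟨_, z, hz, rfl, fun w => ?_⟩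
  have hw0 : 0 ≤ w ⬝ᵥ w := Finset.sum_nonneg fun i _ => mul_self_nonneg _
  rcases hw0.eq_or_lt with h | h
  · rw [dotProduct_self_eq_zero.1 h.symm]; simp
  · have hs : (√(w ⬝ᵥ w))⁻¹ * (√(w ⬝ᵥ w))⁻¹ * (w ⬝ᵥ w) = 1 := by
      rw [← mul_inv, Real.mul_self_sqrt hw0, inv_mul_cancel₀ h.ne']
    have := hmax (show (√(w ⬝ᵥ w))⁻¹ • w ∈ {z : V → ℝ | z ⬝ᵥ z = 1} by
      simpa [← mul_assoc] using hs)
    simp only [Set.mem_ofPred_eq, mulVec_smul, dotProduct_smul, smul_dotProduct, smul_eq_mul] at this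
    rw [← mul_assoc] at this
    calc w ⬝ᵥ M *ᵥ w = (√(w ⬝ᵥ w))⁻¹ * (√(w ⬝ᵥ w))⁻¹ * (w ⬝ᵥ M *ᵥ w) * (w ⬝ᵥ w) := by
          linear_combination (-(w ⬝ᵥ M *ᵥ w)) * hs
      _ ≤ _ := mul_le_mul_of_nonneg_right this hw0

open Matrix in
/-- Perron–Frobenius for symmetric nonnegative matrices, without irreducibility. -/
theorem exists_nonneg_perron {V : Type*} [Fintype V] [DecidableEq V] [Nonempty V]
    {M : Matrix V V ℝ} (hs : M.IsHermitian) (hM : ∀ i j, 0 ≤ M i j) :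
    ∃ (ρ : ℝ) (x : V → ℝ), 0 ≤ ρ ∧ spectralRadius ℝ M = ENNReal.ofReal ρ ∧ (∀ v, 0 ≤ x v) ∧ x ≠ 0 ∧
      M *ᵥ x = ρ • x ∧ (∀ w : V → ℝ, w ⬝ᵥ M *ᵥ w ≤ ρ * (w ⬝ᵥ w)) ∧
      ∀ w : V → ℝ, w ⬝ᵥ M *ᵥ w = ρ * (w ⬝ᵥ w) → M *ᵥ w = ρ • w := by
  obtain ⟨ρ, z, hz, hzρ, hmax⟩ := exists_rayleigh_max M
  have habs : ∀ w : V → ℝ, (fun v => |w v|) ⬝ᵥ (fun v => |w v|) = w ⬝ᵥ w := by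
    intro w; simp [dotProduct]
  have hρ : |ρ| ≤ ρ := by
    calc |ρ| = |z ⬝ᵥ M *ᵥ z| := by rw [hzρ]
      _ ≤ _ := abs_dotProduct_mulVec_le hM z
      _ ≤ _ := hmax _
      _ = ρ := by rw [habs, hz, mul_one]
  have hform : ∀ w : V → ℝ, w ⬝ᵥ (ρ • (1 : Matrix V V ℝ) - M) *ᵥ w
      = ρ * (w ⬝ᵥ w) - w ⬝ᵥ M *ᵥ w := by
    intro w
    rw [sub_mulVec, dotProduct_sub, smul_mulVec, one_mulVec, dotProduct_smul, smul_eq_mul]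
  have hpsd : (ρ • (1 : Matrix V V ℝ) - M).PosSemidef := by
    refine PosSemidef.of_dotProduct_mulVec_nonneg ?_ fun w => ?_
    · refine IsHermitian.sub ?_ hs
      simp [IsHermitian]
    · rw [star_trivial, hform]
      linarith [hmax w]
  have heq : ∀ w : V → ℝ, w ⬝ᵥ M *ᵥ w = ρ * (w ⬝ᵥ w) → M *ᵥ w = ρ • w := by
    intro w hw
    have h0 := (hpsd.dotProduct_mulVec_zero_iff w).1 (by rw [star_trivial, hform, hw, sub_self])
    rw [sub_mulVec, smul_mulVec, one_mulVec] at h0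
    exact (sub_eq_zero.1 h0).symm
  have hx0 : (fun v => |z v|) ≠ 0 := by
    intro h
    have := habs z
    rw [h, hz] at this
    simp at this
  have hxe : M *ᵥ (fun v => |z v|) = ρ • (fun v => |z v|) := by
    refine heq _ (le_antisymm (hmax _) ?_)
    rw [habs, hz, mul_one]
    calc ρ ≤ |z ⬝ᵥ M *ᵥ z| := by rw [hzρ]; exact le_abs_self _
      _ ≤ _ := abs_dotProduct_mulVec_le hM z
  have hspec : ∀ k : ℝ, k ∈ spectrum ℝ M ↔ ∃ w : V → ℝ, w ≠ 0 ∧ M *ᵥ w = k • w := by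
    intro k
    rw [← spectrum_toLin', ← Module.End.hasEigenvalue_iff_mem_spectrum]
    constructor
    · intro h
      obtain ⟨w, hw⟩ := h.exists_hasEigenvector
      exact ⟨w, hw.2, by simpa using hw.apply_eq_smul⟩
    · rintro ⟨w, hw0, hw⟩
      exact Module.End.hasEigenvalue_of_hasEigenvector
        (x := w) (Module.End.hasEigenvector_iff.2 ⟨Module.End.mem_eigenspace_iff.2 (by simpa), hw0⟩)
  have hρ0 : 0 ≤ ρ := (abs_nonneg ρ).trans hρ
  refine ⟨ρ, fun v => |z v|, hρ0, ?_, fun v => abs_nonneg _, hx0, hxe, hmax, heq⟩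
  apply le_antisymm
  · refine iSup₂_le fun k hk => ?_
    obtain ⟨w, hw0, hw⟩ := (hspec k).1 hk
    have hpos : 0 < w ⬝ᵥ w := (Finset.sum_nonneg fun i _ => mul_self_nonneg _).lt_of_ne
      fun h => hw0 (dotProduct_self_eq_zero.1 h.symm)
    have h1 := (abs_dotProduct_mulVec_le hM w).trans (hmax _)
    rw [habs, hw, dotProduct_smul, smul_eq_mul, abs_mul, abs_of_pos hpos] at h1
    have h2 : |k| ≤ ρ := le_of_mul_le_mul_right h1 hpos
    change ‖k‖ₑ ≤ _
    rw [Real.enorm_eq_ofReal_abs]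
    exact ENNReal.ofReal_le_ofReal h2
  · have hk := (hspec ρ).2 ⟨_, hx0, hxe⟩
    refine le_trans (le_of_eq ?_) (le_iSup₂ (f := fun k (_ : k ∈ spectrum ℝ M) => (‖k‖₊ : ℝ≥0∞)) ρ hk)
    change _ = ‖ρ‖ₑ
    rw [Real.enorm_eq_ofReal_abs, abs_of_nonneg hρ0]

open Matrix in
theorem aAlphaMatrix_mulVec {V : Type*} [Fintype V] [DecidableEq V] (α : ℝ) (G : SimpleGraph V)
    [DecidableRel G.Adj] (z : V → ℝ) (v : V) :
    (aAlphaMatrix α G *ᵥ z) v =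
      α * (G.degree v * z v) + (1 - α) * ∑ u ∈ G.neighborFinset v, z u := by
  simp only [aAlphaMatrix, add_mulVec, smul_mulVec, Pi.add_apply, Pi.smul_apply, smul_eq_mul,
    SimpleGraph.degMatrix_mulVec_apply, SimpleGraph.adjMatrix_mulVec_apply]

open Matrix in
/-- Perron–Frobenius for `A_α` of a connected graph. -/
theorem SimpleGraph.Connected.exists_perron {V : Type*} [Fintype V] [DecidableEq V]
    {G : SimpleGraph V} [DecidableRel G.Adj] (hG : G.Connected) {α : ℝ} (h0 : 0 ≤ α) (h1 : α < 1) :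
    ∃ (ρ : ℝ) (x : V → ℝ), 0 ≤ ρ ∧ aAlphaSpectralRadius α G = ENNReal.ofReal ρ ∧ (∀ v, 0 < x v) ∧
      aAlphaMatrix α G *ᵥ x = ρ • x ∧
      (∀ w : V → ℝ, w ⬝ᵥ aAlphaMatrix α G *ᵥ w ≤ ρ * (w ⬝ᵥ w)) ∧
      ∀ w : V → ℝ, w ⬝ᵥ aAlphaMatrix α G *ᵥ w = ρ * (w ⬝ᵥ w) →
        aAlphaMatrix α G *ᵥ w = ρ • w := by
  have := hG.nonempty
  have hs : (aAlphaMatrix α G).IsHermitian := by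
    have h2 := G.isHermitian_degMatrix ℝ
    have h3 := G.isHermitian_adjMatrix ℝ
    unfold aAlphaMatrix
    refine IsHermitian.add ?_ ?_
    · rw [IsHermitian, conjTranspose_smul, h2.eq, star_trivial]
    · rw [IsHermitian, conjTranspose_smul, h3.eq, star_trivial]
  have hM : ∀ i j, 0 ≤ aAlphaMatrix α G i j := by
    intro i j
    have : 0 ≤ 1 - α := by linarith
    simp only [aAlphaMatrix, Matrix.add_apply, Matrix.smul_apply, smul_eq_mul, SimpleGraph.degMatrix,
      diagonal_apply, SimpleGraph.adjMatrix_apply]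
    split_ifs <;> positivity
  obtain ⟨ρ, x, hρ, hrad, hx, hx0, hxe, hmax, heq⟩ := exists_nonneg_perron hs hM
  refine ⟨ρ, x, hρ, hrad, fun v => ?_, hxe, hmax, heq⟩
  have hstep : ∀ u w, G.Adj u w → x u = 0 → x w = 0 := by
    intro u w huw hu
    have := congrFun hxe u
    rw [aAlphaMatrix_mulVec, Pi.smul_apply, hu, smul_zero, mul_zero, mul_zero, zero_add] at this
    have h3 := (mul_eq_zero.1 this).resolve_left (by linarith)
    exact (Finset.sum_eq_zero_iff_of_nonneg fun i _ => hx i).1 h3 w (by simpa using huw)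
  refine (hx v).lt_of_ne fun hv => hx0 (funext fun w => ?_)
  obtain ⟨W⟩ := hG.preconnected v w
  induction W with
  | nil => exact hv.symm
  | cons h _ ih => exact ih (hstep _ _ h hv.symm).symm

open Matrix in
theorem aAlphaSpectralRadius_eq_of_iso {V W : Type*} [Fintype V] [DecidableEq V] [Fintype W]
    [DecidableEq W] (α : ℝ) {G : SimpleGraph V} [DecidableRel G.Adj] {H : SimpleGraph W}
    [DecidableRel H.Adj] (e : G ≃g H) : aAlphaSpectralRadius α G = aAlphaSpectralRadius α H := by
  have h : reindexAlgEquiv ℝ ℝ e.toEquiv (aAlphaMatrix α G) = aAlphaMatrix α H := by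
    ext i j
    have hd : G.degree (e.symm i) = H.degree i := e.symm.degree_eq i
    have ha : G.Adj (e.symm i) (e.symm j) ↔ H.Adj i j := e.symm.map_adj_iff
    have he : ∀ k, e.toEquiv.symm k = e.symm k := fun _ => rfl
    simp [aAlphaMatrix, SimpleGraph.degMatrix, diagonal_apply, SimpleGraph.adjMatrix_apply, he, hd,
      ha]
  unfold aAlphaSpectralRadius spectralRadius
  rw [← h, AlgEquiv.spectrum_eq]

/-- `p` sends each vertex `v ≠ r` to its parent, for the graph `G` rooted at `r`: the edges of `G`
are the pairs `{v, p v}` with `v ≠ r`, each arising from exactly one `v`. -/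
structure IsParentMap {V : Type*} (G : SimpleGraph V) (r : V) (p : V → V) : Prop where
  adj_iff : ∀ u v, G.Adj u v ↔ (u ≠ r ∧ p u = v) ∨ (v ≠ r ∧ p v = u)
  asymm : ∀ u v, u ≠ r → v ≠ r → p u = v → p v ≠ u

theorem SimpleGraph.IsTree.exists_isParentMap {V : Type*} {G : SimpleGraph V} (hG : G.IsTree)
    (r : V) : ∃ p, IsParentMap G r p := by
  choose P hP _ using hG.existsUnique_path r
  have key : ∀ v w, G.Adj v w → v ∈ (P w).support →
      w ≠ r ∧ (P w).penultimate = v ∧ (P w).length = (P v).length + 1 := by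
    intro v w hvw hv
    have h := hG.isAcyclic.path_concat (hP v) (hP w) hvw hv
    refine ⟨?_, by rw [h, SimpleGraph.Walk.penultimate_concat],
      by rw [h, SimpleGraph.Walk.length_concat]⟩
    rintro rfl
    have h1 := SimpleGraph.Walk.length_eq_zero_iff.2 (SimpleGraph.Walk.isPath_iff_nil.1 (hP w))
    rw [h, SimpleGraph.Walk.length_concat] at h1
    omega
  have hadj : ∀ v, v ≠ r → G.Adj (P v).penultimate v := fun v hv =>
    (P v).adj_penultimate (SimpleGraph.Walk.not_nil_of_ne hv.symm)
  have hlen : ∀ v, v ≠ r → (P v).length = (P (P v).penultimate).length + 1 := fun v hv =>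
    (key _ _ (hadj v hv) ((P v).getVert_mem_support _)).2.2
  refine ⟨fun v => (P v).penultimate, fun u v => ⟨fun h => ?_, ?_⟩, fun u v hu hv h h' => ?_⟩
  · by_cases hu : u ∈ (P v).support
    · exact .inr ⟨(key u v h hu).1, (key u v h hu).2.1⟩
    · have := hG.isAcyclic.mem_support_of_ne_mem_support_of_adj_of_isPath (hP u) (hP v) h hu
      exact .inl ⟨(key v u h.symm this).1, (key v u h.symm this).2.1⟩
  · rintro (⟨hu, rfl⟩ | ⟨hv, rfl⟩)
    · exact (hadj u hu).symm
    · exact hadj v hv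
  · have h1 := hlen u hu
    have h2 := hlen v hv
    rw [show (P u).penultimate = v from h] at h1
    rw [show (P v).penultimate = u from h'] at h2
    omega

namespace IsParentMap

variable {V : Type*} [Fintype V] [DecidableEq V] {r : V} {p : V → V}

/-- The vertices whose parent is `v`. -/
def children (r : V) (p : V → V) (v : V) : Finset V :=
  Finset.univ.filter fun u => u ≠ r ∧ p u = v

theorem mem_children {u v : V} : u ∈ children r p v ↔ u ≠ r ∧ p u = v := by
  simp [children]

theorem sum_sum_children {R : Type*} [AddCommMonoid R] (g : V → V → R) :
    ∑ v, ∑ u ∈ children r p v, g v u = ∑ u ∈ Finset.univ.erase r, g (p u) u := by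
  have h1 : ∀ v, ∑ u ∈ children r p v, g v u =
      ∑ u ∈ (Finset.univ.erase r).filter (fun u => p u = v), g (p u) u := by
    intro v
    refine Finset.sum_congr ?_ ?_
    · ext u; simp [mem_children]
    · intro u hu
      rw [(Finset.mem_filter.1 hu).2]
  simp_rw [h1]
  exact Finset.sum_fiberwise _ _ _

variable {G : SimpleGraph V} [DecidableRel G.Adj]

theorem sum_neighborFinset_root (h : IsParentMap G r p) {R : Type*} [AddCommMonoid R] (f : V → R) :
    ∑ u ∈ G.neighborFinset r, f u = ∑ u ∈ children r p r, f u := by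
  refine Finset.sum_congr ?_ fun _ _ => rfl
  ext u
  simp [mem_children, h.adj_iff]

theorem sum_neighborFinset (h : IsParentMap G r p) {R : Type*} [AddCommMonoid R] (f : V → R)
    {v : V} (hv : v ≠ r) :
    ∑ u ∈ G.neighborFinset v, f u = f (p v) + ∑ u ∈ children r p v, f u := by
  have hnot : p v ∉ children r p v := by
    rw [mem_children]
    exact fun h' => h.asymm v (p v) hv h'.1 rfl h'.2
  rw [← Finset.sum_insert hnot]
  refine Finset.sum_congr ?_ fun _ _ => rfl
  ext u
  simp [mem_children, h.adj_iff, hv, eq_comm]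

theorem degree_root (h : IsParentMap G r p) : G.degree r = (children r p r).card := by
  simpa using h.sum_neighborFinset_root (fun _ => (1 : ℕ))

theorem degree_eq (h : IsParentMap G r p) {v : V} (hv : v ≠ r) :
    G.degree v = (children r p v).card + 1 := by
  have := h.sum_neighborFinset (fun _ => (1 : ℕ)) hv
  simp at this
  omega

/-- Summing over the edges at each vertex counts each edge twice. -/
theorem sum_sum_neighborFinset (h : IsParentMap G r p) (z : V → ℝ) :
    ∑ v, z v * ∑ u ∈ G.neighborFinset v, z u = 2 * ∑ u ∈ Finset.univ.erase r, z u * z (p u) := by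
  have h1 := sum_sum_children (r := r) (p := p) fun v u => z v * z u
  have h2 : ∀ v ∈ Finset.univ.erase r, z v * ∑ u ∈ G.neighborFinset v, z u =
      z v * z (p v) + ∑ u ∈ children r p v, z v * z u := by
    intro v hv
    rw [h.sum_neighborFinset z (Finset.ne_of_mem_erase hv), mul_add, Finset.mul_sum]
  rw [← Finset.add_sum_erase _ _ (Finset.mem_univ r)] at h1 ⊢
  rw [h.sum_neighborFinset_root, Finset.sum_congr rfl h2, Finset.sum_add_distrib, Finset.mul_sum]
  have h3 : ∑ u ∈ Finset.univ.erase r, z (p u) * z u = ∑ u ∈ Finset.univ.erase r, z u * z (p u) :=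
    Finset.sum_congr rfl fun _ _ => mul_comm _ _
  rw [h3] at h1
  linarith

open Matrix in
theorem dotProduct_aAlphaMatrix (h : IsParentMap G r p) (α : ℝ) (z : V → ℝ) :
    z ⬝ᵥ aAlphaMatrix α G *ᵥ z = α * (∑ v, G.degree v * z v ^ 2) +
      (1 - α) * (2 * ∑ u ∈ Finset.univ.erase r, z u * z (p u)) := by
  rw [← h.sum_sum_neighborFinset, dotProduct, Finset.mul_sum, Finset.mul_sum,
    ← Finset.sum_add_distrib]
  refine Finset.sum_congr rfl fun v _ => ?_
  rw [aAlphaMatrix_mulVec]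
  ring

end IsParentMap

/-- The numbering of a rooted tree on `0, …, n` with parent map `p` is a breadth-first one. -/
structure IsBFSParentMap {n : ℕ} (p : Fin (n + 1) → Fin (n + 1)) : Prop where
  lt : ∀ k, k ≠ 0 → p k < k
  mono : ∀ j k, j ≠ 0 → j ≤ k → p j ≤ p k

section bfs

variable {n : ℕ} {d : Fin (n + 1) → ℕ}

/-- The first number left for the children of the vertices from `t` on. -/
def bfsOffset (d : Fin (n + 1) → ℕ) (t : ℕ) : ℕ :=
  1 + ∑ j ∈ Finset.univ.filter (fun j : Fin (n + 1) => (j : ℕ) < t), bfsNumChildren d j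

theorem bfsFirstChild_eq_offset (i : Fin (n + 1)) : bfsFirstChild d i = bfsOffset d i := rfl

theorem bfsOffset_zero : bfsOffset d 0 = 1 := by simp [bfsOffset]

theorem bfsOffset_succ (i : Fin (n + 1)) :
    bfsOffset d (i + 1) = bfsOffset d i + bfsNumChildren d i := by
  have h : Finset.univ.filter (fun j : Fin (n + 1) => (j : ℕ) < i + 1) =
      insert i (Finset.univ.filter (fun j : Fin (n + 1) => (j : ℕ) < i)) := by
    ext j
    simp only [Finset.mem_filter, Finset.mem_univ, true_and, Finset.mem_insert, Fin.ext_iff]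
    omega
  rw [bfsOffset, h, Finset.sum_insert (by simp), bfsOffset]
  omega

theorem bfsOffset_mono : Monotone (bfsOffset d) := by
  intro s t hst
  refine Nat.add_le_add_left (Finset.sum_le_sum_of_subset fun j hj => ?_) _
  simp only [Finset.mem_filter, Finset.mem_univ, true_and] at hj ⊢
  omega

theorem bfsOffset_last (hsum : ∑ i, d i = 2 * n) (hpos : 1 ≤ n → ∀ i, 1 ≤ d i) :
    bfsOffset d (n + 1) = n + 1 := by
  have h : Finset.univ.filter (fun j : Fin (n + 1) => (j : ℕ) < n + 1) = Finset.univ := by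
    ext j; simpa using Nat.le_of_lt_succ j.isLt
  rw [bfsOffset, h, Fin.sum_univ_succ]
  rw [Fin.sum_univ_succ] at hsum
  have h1 : ∑ i : Fin n, (bfsNumChildren d i.succ + 1) = ∑ i : Fin n, d i.succ := by
    refine Finset.sum_congr rfl fun i _ => ?_
    have := hpos (by have := i.isLt; omega) i.succ
    simp [bfsNumChildren]
    omega
  rw [Finset.sum_add_distrib] at h1
  simp at h1
  have h2 : bfsNumChildren d 0 = d 0 := by simp [bfsNumChildren]
  omega

theorem lt_bfsOffset (hmono : Antitone d) (hsum : ∑ i, d i = 2 * n)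
    (hpos : 1 ≤ n → ∀ i, 1 ≤ d i) {t : ℕ} (ht : t ≤ n) : t < bfsOffset d t := by
  rcases Nat.eq_zero_or_pos t with rfl | ht0
  · simp [bfsOffset_zero]
  by_cases h : ∀ j : Fin (n + 1), (j : ℕ) < t → 1 ≤ bfsNumChildren d j
  · have h1 := Finset.sum_le_sum (s := Finset.univ.filter (fun j : Fin (n + 1) => (j : ℕ) < t))
      (f := fun _ => 1) (g := bfsNumChildren d) fun j hj => h j (by simpa using hj)
    have h2 : (Finset.univ.filter (fun j : Fin (n + 1) => (j : ℕ) < t)).card = t := by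
      rw [Fin.card_filter_val_lt]
      omega
    simp only [Finset.sum_const, h2, smul_eq_mul, mul_one] at h1
    rw [bfsOffset]
    omega
  · push Not at h
    obtain ⟨j, hjt, hj⟩ := h
    have h1 : ∀ k : Fin (n + 1), j ≤ k → bfsNumChildren d k = 0 := by
      intro k hk
      have h2 := hpos (by omega) j
      have h3 := hmono hk
      rw [bfsNumChildren] at hj ⊢
      have : (j : ℕ) ≤ k := hk
      split_ifs at hj ⊢ <;> omega
    have h2 : bfsOffset d t = bfsOffset d (n + 1) := by
      refine congrArg (1 + ·) (Finset.sum_subset (fun k hk => ?_) fun k _ hk => h1 k ?_)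
      · simp only [Finset.mem_filter, Finset.mem_univ, true_and] at hk ⊢
        omega
      · simp only [Finset.mem_filter, Finset.mem_univ, true_and] at hk
        rw [Fin.le_def]
        omega
    rw [h2, bfsOffset_last hsum hpos]
    omega

theorem isBFSChild_iff (i k : Fin (n + 1)) :
    IsBFSChild d i k ↔ bfsOffset d i ≤ k ∧ (k : ℕ) < bfsOffset d (i + 1) := by
  rw [bfsOffset_succ, IsBFSChild, bfsFirstChild_eq_offset]

theorem IsBFSChild.ne_zero {i k : Fin (n + 1)} (h : IsBFSChild d i k) : k ≠ 0 := by
  rintro rfl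
  have h1 := ((isBFSChild_iff _ _).1 h).1
  have h2 := bfsOffset_mono (d := d) (Nat.zero_le i)
  rw [bfsOffset_zero] at h2
  simp at h1
  omega

theorem IsBFSChild.le_of_le {i j k l : Fin (n + 1)} (h : IsBFSChild d i k)
    (h' : IsBFSChild d j l) (hkl : k ≤ l) : i ≤ j := by
  rw [isBFSChild_iff] at h h'
  by_contra! hij
  have h1 : (j : ℕ) + 1 ≤ i := hij
  have h2 := bfsOffset_mono (d := d) h1
  have h3 : (k : ℕ) ≤ l := hkl
  omega

theorem exists_isBFSChild (hmono : Antitone d) (hsum : ∑ i, d i = 2 * n)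
    (hpos : 1 ≤ n → ∀ i, 1 ≤ d i) {k : Fin (n + 1)} (hk : k ≠ 0) :
    ∃ i < k, IsBFSChild d i k := by
  have hex : ∃ t, (k : ℕ) < bfsOffset d t := ⟨k, lt_bfsOffset hmono hsum hpos (by omega)⟩
  have h1 := Nat.find_spec hex
  have h2 : Nat.find hex ≤ k := Nat.find_min' hex (lt_bfsOffset hmono hsum hpos (by omega))
  have hk0 : (k : ℕ) ≠ 0 := fun h => hk (Fin.ext h)
  have h3 : Nat.find hex ≠ 0 := by
    intro h
    rw [h, bfsOffset_zero] at h1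
    omega
  have h4 := Nat.find_min hex (m := Nat.find hex - 1) (by omega)
  refine ⟨⟨Nat.find hex - 1, by omega⟩, by rw [Fin.lt_def]; simp only; omega, ?_⟩
  rw [isBFSChild_iff]
  simp only
  rw [Nat.sub_add_cancel (by omega)]
  exact ⟨by omega, h1⟩

theorem card_filter_isBFSChild (hsum : ∑ i, d i = 2 * n) (hpos : 1 ≤ n → ∀ i, 1 ≤ d i)
    (i : Fin (n + 1)) : (Finset.univ.filter (IsBFSChild d i)).card = bfsNumChildren d i := by
  have hle : bfsOffset d (i + 1) ≤ n + 1 :=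
    (bfsOffset_mono (by omega)).trans (bfsOffset_last hsum hpos).le
  have h : (Finset.univ.filter (IsBFSChild d i)).map Fin.valEmbedding =
      Finset.Ico (bfsOffset d i) (bfsOffset d (i + 1)) := by
    ext m
    simp only [Finset.mem_map, Finset.mem_filter, Finset.mem_univ, true_and, Finset.mem_Ico,
      Fin.valEmbedding_apply, isBFSChild_iff]
    constructor
    · rintro ⟨k, hk, rfl⟩
      exact hk
    · intro hm
      exact ⟨⟨m, by omega⟩, hm, rfl⟩
  rw [← Finset.card_map, h, Nat.card_Ico, bfsOffset_succ]
  omega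

theorem exists_bfsTree_isParentMap (hmono : Antitone d) (hsum : ∑ i, d i = 2 * n)
    (hpos : 1 ≤ n → ∀ i, 1 ≤ d i) :
    ∃ p, IsParentMap (bfsTree d) 0 p ∧ IsBFSParentMap p ∧ ∀ i, (bfsTree d).degree i = d i := by
  have hex : ∀ k : Fin (n + 1), ∃ i, k ≠ 0 → i < k ∧ IsBFSChild d i k := by
    intro k
    by_cases hk : k = 0
    · exact ⟨0, fun h => absurd hk h⟩
    · obtain ⟨i, hi⟩ := exists_isBFSChild hmono hsum hpos hk
      exact ⟨i, fun _ => hi⟩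
  choose p hp using hex
  have hchild : ∀ i k, IsBFSChild d i k ↔ k ≠ 0 ∧ p k = i := by
    refine fun i k => ⟨fun h => ⟨h.ne_zero, ?_⟩, ?_⟩
    · have h' := (hp k h.ne_zero).2
      exact le_antisymm (h'.le_of_le h le_rfl) (h.le_of_le h' le_rfl)
    · rintro ⟨hk, rfl⟩
      exact (hp k hk).2
  have hpar : IsParentMap (bfsTree d) 0 p := by
    refine ⟨fun u v => ?_, fun u v hu hv h h' => ?_⟩
    · change (u ≠ v ∧ (IsBFSChild d u v ∨ IsBFSChild d v u)) ↔ _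
      rw [hchild, hchild]
      constructor
      · rintro ⟨_, h | h⟩
        · exact .inr h
        · exact .inl h
      · rintro (⟨h, rfl⟩ | ⟨h, rfl⟩)
        · exact ⟨(hp u h).1.ne', .inr ⟨h, rfl⟩⟩
        · exact ⟨(hp v h).1.ne, .inl ⟨h, rfl⟩⟩
    · have h1 := (hp u hu).1
      have h2 := (hp v hv).1
      rw [h] at h1
      rw [h'] at h2
      exact lt_asymm h1 h2
  refine ⟨p, hpar, ⟨fun k hk => (hp k hk).1, fun j k hj hjk => ?_⟩, fun i => ?_⟩
  · have hk : k ≠ 0 := by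
      rintro rfl
      exact hj (le_antisymm hjk (Fin.zero_le _))
    exact (hp j hj).2.le_of_le (hp k hk).2 hjk
  · have hcard : (IsParentMap.children 0 p i).card = bfsNumChildren d i := by
      rw [← card_filter_isBFSChild hsum hpos i]
      congr 1
      ext k
      simp [IsParentMap.mem_children, hchild]
    by_cases hi : i = 0
    · subst hi
      rw [hpar.degree_root, hcard]
      simp [bfsNumChildren]
    · have h0 : (i : ℕ) ≠ 0 := fun h => hi (Fin.ext h)
      have := hpos (by omega) i
      rw [hpar.degree_eq hi, hcard, bfsNumChildren, if_neg h0]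
      omega

theorem IsParentMap.isTree {G : SimpleGraph (Fin (n + 1))} [DecidableRel G.Adj]
    {p : Fin (n + 1) → Fin (n + 1)} (h : IsParentMap G 0 p) (hp : IsBFSParentMap p) :
    G.IsTree := by
  rw [SimpleGraph.isTree_iff_connected_and_card]
  constructor
  · have hreach : ∀ k, G.Reachable 0 k := by
      intro k
      induction k using WellFoundedLT.induction with
      | ind k ih =>
        by_cases hk : k = 0
        · rw [hk]
        · exact (ih (p k) (hp.lt k hk)).trans ((h.adj_iff _ _).2 (.inr ⟨hk, rfl⟩)).reachable
    exact ⟨fun u v => (hreach u).symm.trans (hreach v)⟩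
  · have h1 := G.sum_degrees_eq_twice_card_edges
    have h2 := IsParentMap.sum_sum_children (r := (0 : Fin (n + 1))) (p := p) fun _ _ => 1
    simp only [Finset.sum_const, smul_eq_mul, mul_one, Finset.card_erase_of_mem (Finset.mem_univ _),
      Finset.card_univ, Fintype.card_fin] at h2
    rw [Fin.sum_univ_succ] at h1 h2
    rw [h.degree_root, Finset.sum_congr rfl fun i _ => h.degree_eq (Fin.succ_ne_zero i),
      Finset.sum_add_distrib] at h1
    simp at h1
    rw [Nat.card_eq_fintype_card, ← SimpleGraph.edgeFinset_card, Nat.card_eq_fintype_card,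
      Fintype.card_fin]
    omega

end bfs

/-- A positive nonincreasing sequence is a nonnegative combination of indicators of initial
segments; those ending a block of equal values have a positive coefficient. -/
theorem Antitone.exists_layers {n : ℕ} {y : Fin (n + 1) → ℝ} (hy : Antitone y)
    (hpos : ∀ i, 0 < y i) :
    ∃ w : Fin (n + 1) → ℝ, (∀ t, 0 ≤ w t) ∧ (∀ k, y k = ∑ t, if k ≤ t then w t else 0) ∧
      ∀ k, ∃ t, y t = y k ∧ 0 < w t ∧ ∀ j, y j = y k → j ≤ t := by
  set Y : ℕ → ℝ := fun m => if h : m < n + 1 then y ⟨m, h⟩ else 0 with hY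
  have hYk : ∀ k : Fin (n + 1), Y k = y k := fun k => by simp only [hY, dif_pos k.isLt]
  refine ⟨fun t => Y t - Y (t + 1), fun t => ?_, fun k => ?_, fun k => ?_⟩
  · simp only [sub_nonneg, hYk]
    by_cases h : (t : ℕ) + 1 < n + 1
    · simp only [hY, dif_pos h]
      exact hy (by rw [Fin.le_def]; simp)
    · simp only [hY, dif_neg h]
      exact (hpos t).le
  · have h1 : (∑ t : Fin (n + 1), if k ≤ t then Y t - Y (t + 1) else 0) =
        ∑ m ∈ Finset.range (n + 1), (Y (max m k) - Y (max (m + 1) k)) := by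
      rw [← Fin.sum_univ_eq_sum_range (fun m => Y (max m k) - Y (max (m + 1) k))]
      refine Finset.sum_congr rfl fun t _ => ?_
      split_ifs with h
      · have : (k : ℕ) ≤ t := h
        rw [max_eq_left this, max_eq_left (by omega)]
      · have : (t : ℕ) < k := not_le.1 h
        rw [max_eq_right this.le, max_eq_right this, sub_self]
    rw [h1, Finset.sum_range_sub', max_eq_right (Nat.zero_le _), max_eq_left k.isLt.le, hYk]
    simp [hY]
  · obtain ⟨t, ht, htmax⟩ := (Finset.univ.filter fun j => y j = y k).exists_max_image id
      ⟨k, by simp⟩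
    simp only [Finset.mem_filter, Finset.mem_univ, true_and, id] at ht htmax
    refine ⟨t, ht, ?_, htmax⟩
    simp only [sub_pos, hYk]
    by_cases h : (t : ℕ) + 1 < n + 1
    · simp only [hY, dif_pos h]
      have hlt : t < ⟨t + 1, h⟩ := by rw [Fin.lt_def]; simp
      refine (hy hlt.le).lt_of_ne fun he => ?_
      exact absurd (htmax _ (he.trans ht)) (not_le.2 hlt)
    · simp only [hY, dif_neg h]
      exact hpos t

section rearrangement

variable {n : ℕ} {p q : Fin (n + 1) → Fin (n + 1)}

/-- The number of nonroot vertices `k ≤ s` whose parent is at most `t`. -/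
def parentCount (p : Fin (n + 1) → Fin (n + 1)) (s t : Fin (n + 1)) : ℕ :=
  ((Finset.univ.erase 0).filter fun k => k ≤ s ∧ p k ≤ t).card

theorem sum_mul_parent_eq {y w : Fin (n + 1) → ℝ}
    (hw : ∀ k, y k = ∑ t, if k ≤ t then w t else 0) :
    ∑ k ∈ Finset.univ.erase 0, y k * y (p k) = ∑ s, ∑ t, w s * w t * parentCount p s t := by
  have h1 : ∀ k, y k * y (p k) =
      ∑ s, ∑ t, w s * w t * (if k ≤ s ∧ p k ≤ t then 1 else 0) := by
    intro k
    rw [hw k, hw (p k), Finset.sum_mul_sum]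
    refine Finset.sum_congr rfl fun s _ => Finset.sum_congr rfl fun t _ => ?_
    by_cases h1 : k ≤ s <;> by_cases h2 : p k ≤ t <;> simp [h1, h2]
  simp_rw [h1]
  rw [Finset.sum_comm]
  refine Finset.sum_congr rfl fun s _ => ?_
  rw [Finset.sum_comm]
  refine Finset.sum_congr rfl fun t _ => ?_
  rw [← Finset.mul_sum, parentCount, Finset.sum_boole]

theorem parentCount_le (hq : IsBFSParentMap q)
    (hcount : ∀ t, ((Finset.univ.erase 0).filter fun k => p k ≤ t).card ≤
      ((Finset.univ.erase 0).filter fun k => q k ≤ t).card) (s t : Fin (n + 1)) :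
    parentCount p s t ≤ parentCount q s t := by
  by_cases h : ∀ k ∈ Finset.univ.erase (0 : Fin (n + 1)), k ≤ s → q k ≤ t
  · refine Finset.card_le_card fun k hk => ?_
    rw [Finset.mem_filter] at hk ⊢
    exact ⟨hk.1, hk.2.1, h k hk.1 hk.2.1⟩
  · push Not at h
    obtain ⟨a, ha0, has, hat⟩ := h
    calc parentCount p s t ≤ _ := Finset.card_le_card (t := (Finset.univ.erase 0).filter
            fun k => p k ≤ t) fun k hk => by
              rw [Finset.mem_filter] at hk ⊢
              exact ⟨hk.1, hk.2.2⟩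
      _ ≤ _ := hcount t
      _ ≤ parentCount q s t := Finset.card_le_card fun k hk => by
          rw [Finset.mem_filter] at hk ⊢
          refine ⟨hk.1, ?_, hk.2⟩
          by_contra! hks
          exact absurd (hq.mono a k (Finset.ne_of_mem_erase ha0) (has.trans hks.le))
            (not_le.2 (hk.2.trans_lt hat))

theorem sum_mul_parent_le {y : Fin (n + 1) → ℝ} (hy : Antitone y) (hpos : ∀ i, 0 < y i)
    (hq : IsBFSParentMap q)
    (hcount : ∀ t, ((Finset.univ.erase 0).filter fun k => p k ≤ t).card ≤
      ((Finset.univ.erase 0).filter fun k => q k ≤ t).card) :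
    ∑ k ∈ Finset.univ.erase 0, y k * y (p k) ≤ ∑ k ∈ Finset.univ.erase 0, y k * y (q k) := by
  obtain ⟨w, hw0, hw, -⟩ := hy.exists_layers hpos
  rw [sum_mul_parent_eq hw, sum_mul_parent_eq hw]
  refine Finset.sum_le_sum fun s _ => Finset.sum_le_sum fun t _ => ?_
  exact mul_le_mul_of_nonneg_left (by exact_mod_cast parentCount_le hq hcount s t)
    (mul_nonneg (hw0 s) (hw0 t))

theorem parent_value_eq_of_sum_eq {y : Fin (n + 1) → ℝ} (hy : Antitone y) (hpos : ∀ i, 0 < y i)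
    (hq : IsBFSParentMap q)
    (hcount : ∀ t, ((Finset.univ.erase 0).filter fun k => p k ≤ t).card ≤
      ((Finset.univ.erase 0).filter fun k => q k ≤ t).card)
    (hcls : ∀ j k, j ≠ 0 → k ≠ 0 → y j = y k → y (q j) = y (q k))
    (heq : ∑ k ∈ Finset.univ.erase 0, y k * y (p k) =
      ∑ k ∈ Finset.univ.erase 0, y k * y (q k)) {k : Fin (n + 1)} (hk : k ≠ 0) :
    y (p k) = y (q k) := by
  obtain ⟨w, hw0, hw, hlast⟩ := hy.exists_layers hpos
  have hN : ∀ s t, 0 < w s → 0 < w t → parentCount p s t = parentCount q s t := by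
    intro s t hs ht
    have h0 : ∀ s t, w s * w t * (parentCount p s t : ℝ) ≤ w s * w t * parentCount q s t :=
      fun s t => mul_le_mul_of_nonneg_left (by exact_mod_cast parentCount_le hq hcount s t)
        (mul_nonneg (hw0 s) (hw0 t))
    rw [sum_mul_parent_eq hw, sum_mul_parent_eq hw] at heq
    have h1 := (Finset.sum_eq_sum_iff_of_le
      fun s _ => Finset.sum_le_sum fun t _ => h0 s t).1 heq s (Finset.mem_univ s)
    have h2 := (Finset.sum_eq_sum_iff_of_le fun t _ => h0 s t).1 h1 t (Finset.mem_univ t)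
    exact_mod_cast mul_left_cancel₀ (mul_pos hs ht).ne' h2
  have hge : ∀ k ∈ Finset.univ.erase (0 : Fin (n + 1)), y (q k) ≤ y (p k) := by
    intro k hk
    obtain ⟨s, hs, hws, hsmax⟩ := hlast k
    obtain ⟨t, ht, hwt, htmax⟩ := hlast (q k)
    have hk0 := Finset.ne_of_mem_erase hk
    have hks := hsmax k rfl
    have hall : ((Finset.univ.erase (0 : Fin (n + 1))).filter fun j => j ≤ s ∧ q j ≤ t) =
        (Finset.univ.erase (0 : Fin (n + 1))).filter fun j => j ≤ s := by
      refine Finset.filter_congr fun j hj => ⟨And.left, fun hjs => ⟨hjs, ?_⟩⟩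
      have hj0 := Finset.ne_of_mem_erase hj
      rcases le_total j k with hjk | hkj
      · exact (hq.mono j k hj0 hjk).trans (htmax _ rfl)
      · refine htmax _ (hcls j k hj0 hk0 (le_antisymm (hy hkj) ?_))
        rw [← hs]
        exact hy hjs
    have hcard := hN s t hws hwt
    rw [parentCount, parentCount, hall] at hcard
    have hsub : ((Finset.univ.erase (0 : Fin (n + 1))).filter fun j => j ≤ s ∧ p j ≤ t) ⊆
        (Finset.univ.erase (0 : Fin (n + 1))).filter fun j => j ≤ s :=
      Finset.monotone_filter_right _ fun j _ hj => hj.1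
    have hmem : k ∈ (Finset.univ.erase (0 : Fin (n + 1))).filter fun j => j ≤ s :=
      Finset.mem_filter.2 ⟨hk, hks⟩
    rw [← Finset.eq_of_subset_of_card_le hsub hcard.ge, Finset.mem_filter] at hmem
    rw [← ht]
    exact hy hmem.2.2
  have h3 := (Finset.sum_eq_sum_iff_of_le fun k hk =>
    mul_le_mul_of_nonneg_left (hge k hk) (hpos k).le).1 heq.symm k
      (Finset.mem_erase.2 ⟨hk, Finset.mem_univ _⟩)
  exact (mul_left_cancel₀ (hpos k).ne' h3).symm

end rearrangement

section

variable {n : ℕ}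

theorem Antitone.sum_le_sum_of_forall_le {y : Fin (n + 1) → ℝ} (hy : Antitone y)
    (hpos : ∀ i, 0 < y i) {A B : Finset (Fin (n + 1))} (hcard : B.card ≤ A.card)
    (hAB : ∀ a ∈ A, ∀ b ∈ B, a ≤ b) :
    ∑ b ∈ B, y b ≤ ∑ a ∈ A, y a ∧ (∑ b ∈ B, y b = ∑ a ∈ A, y a → B.card = A.card) := by
  rcases A.eq_empty_or_nonempty with rfl | hA
  · simp at hcard
    simp [hcard]
  obtain ⟨m, hm, hmin⟩ := A.exists_min_image y hA
  have h1 : ∑ b ∈ B, y b ≤ B.card * y m := by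
    rw [← nsmul_eq_mul]
    exact Finset.sum_le_card_nsmul _ _ _ fun b hb => hy (hAB m hm b hb)
  have h2 : A.card * y m ≤ ∑ a ∈ A, y a := by
    rw [← nsmul_eq_mul]
    exact Finset.card_nsmul_le_sum _ _ _ hmin
  have h3 : (B.card : ℝ) * y m ≤ A.card * y m :=
    mul_le_mul_of_nonneg_right (by exact_mod_cast hcard) (hpos m).le
  refine ⟨by linarith, fun h => ?_⟩
  exact_mod_cast mul_right_cancel₀ (hpos m).ne' (le_antisymm h3 (by linarith))

theorem IsBFSParentMap.le_of_mem_children {q : Fin (n + 1) → Fin (n + 1)} (hq : IsBFSParentMap q)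
    {i j a b : Fin (n + 1)} (hij : i < j) (ha : a ∈ IsParentMap.children 0 q i)
    (hb : b ∈ IsParentMap.children 0 q j) : a ≤ b := by
  rw [IsParentMap.mem_children] at ha hb
  by_contra! h
  have := hq.mono b a hb.1 h.le
  rw [ha.2, hb.2] at this
  exact absurd hij (not_lt.2 this)

open Matrix IsParentMap in
/-- In a tree with breadth-first numbering and nonincreasing degrees, vertices with equal entries in
a nonincreasing positive eigenvector have equal degrees, and their parents have equal entries. -/
theorem IsParentMap.degree_eq_and_parent_eq {G : SimpleGraph (Fin (n + 1))} [DecidableRel G.Adj]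
    {q : Fin (n + 1) → Fin (n + 1)} (hG : IsParentMap G 0 q) (hq : IsBFSParentMap q)
    (hd : Antitone fun i => G.degree i) {α ρ : ℝ} (h0 : 0 ≤ α) (h1 : α < 1)
    {y : Fin (n + 1) → ℝ} (hy : Antitone y) (hpos : ∀ i, 0 < y i)
    (heig : aAlphaMatrix α G *ᵥ y = ρ • y) {i j : Fin (n + 1)} (hij : i < j) (hyij : y i = y j) :
    G.degree i = G.degree j ∧ (i ≠ 0 → y (q i) = y (q j)) := by
  have hj0 : j ≠ 0 := (lt_of_le_of_lt (Fin.zero_le i) hij).ne'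
  obtain ⟨h, A, hS, hyh, hA, hAj, hih⟩ : ∃ (h : Fin (n + 1)) (A : Finset (Fin (n + 1))),
      ∑ u ∈ G.neighborFinset i, y u = y h + ∑ u ∈ A, y u ∧ y (q j) ≤ y h ∧
      G.degree i = A.card + 1 ∧ (∀ a ∈ A, ∀ b ∈ children 0 q j, a ≤ b) ∧ (i ≠ 0 → q i = h) := by
    by_cases hi : i = 0
    · subst hi
      have hn : 1 < n + 1 := by
        have : 0 < (j : ℕ) := hij
        omega
      have h10 : (⟨1, hn⟩ : Fin (n + 1)) ≠ 0 := by simp [Fin.ext_iff]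
      have hq1 : q ⟨1, hn⟩ = 0 := by
        have h2 : (q ⟨1, hn⟩ : ℕ) < 1 := hq.lt _ h10
        exact Fin.ext (by simpa using h2)
      have hmem : (⟨1, hn⟩ : Fin (n + 1)) ∈ children 0 q 0 := mem_children.2 ⟨h10, hq1⟩
      refine ⟨⟨1, hn⟩, (children 0 q 0).erase ⟨1, hn⟩, ?_, ?_, ?_, ?_, fun h => absurd rfl h⟩
      · rw [hG.sum_neighborFinset_root, Finset.add_sum_erase _ _ hmem]
      · have h2 : y j ≤ y ⟨1, hn⟩ := hy (by rw [Fin.le_def]; exact hij)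
        have h3 : y (q j) ≤ y 0 := hy (Fin.zero_le _)
        linarith
      · rw [hG.degree_root, Finset.card_erase_add_one hmem]
      · exact fun a ha b hb => hq.le_of_mem_children hij (Finset.mem_of_mem_erase ha) hb
    · exact ⟨q i, children 0 q i, hG.sum_neighborFinset y hi, hy (hq.mono i j hi hij.le),
        hG.degree_eq hi, fun a ha b hb => hq.le_of_mem_children hij ha hb, fun _ => rfl⟩
  have hSj := hG.sum_neighborFinset y hj0
  have hdj := hG.degree_eq hj0
  have hdij : G.degree j ≤ G.degree i := hd hij.le
  obtain ⟨hle, heq⟩ := hy.sum_le_sum_of_forall_le hpos (A := A) (B := children 0 q j)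
    (by omega) hAj
  have ei := congrFun heig i
  have ej := congrFun heig j
  rw [aAlphaMatrix_mulVec, Pi.smul_apply, smul_eq_mul, hS] at ei
  rw [aAlphaMatrix_mulVec, Pi.smul_apply, smul_eq_mul, hSj, ← hyij] at ej
  have hdeg : α * (G.degree j * y i) ≤ α * (G.degree i * y i) :=
    mul_le_mul_of_nonneg_left (mul_le_mul_of_nonneg_right (by exact_mod_cast hdij) (hpos i).le) h0
  have hsum : y h + ∑ u ∈ A, y u = y (q j) + ∑ u ∈ children 0 q j, y u := by
    refine le_antisymm ?_ (by linarith)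
    refine le_of_mul_le_mul_left ?_ (sub_pos.2 h1)
    linarith
  refine ⟨?_, fun hi => ?_⟩
  · rw [hA, hdj, heq (by linarith)]
  · rw [hih hi]
    linarith

/-- If `W` has as many elements and the same `y`-sum as an initial segment `K` of `{m, m+1, …}`,
then `W` contains an element with the largest value. -/
theorem Antitone.exists_eq_of_sum_eq {y : Fin (n + 1) → ℝ} (hy : Antitone y)
    {K W : Finset (Fin (n + 1))} {m : Fin (n + 1)} (hmK : m ∈ K)
    (hK : ∀ k ∈ K, ∀ j, m ≤ j → j ≤ k → j ∈ K) (hWm : ∀ w ∈ W, m ≤ w)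
    (hcard : W.card = K.card) (hsum : ∑ w ∈ W, y w = ∑ k ∈ K, y k) : ∃ w ∈ W, y w = y m := by
  by_contra! hne
  have hmW : m ∉ W := fun h => hne m h rfl
  have hmD : m ∈ K \ W := Finset.mem_sdiff.2 ⟨hmK, hmW⟩
  have hcard' : (W \ K).card = (K \ W).card := by
    have h1 := Finset.card_sdiff_add_card_inter W K
    have h2 := Finset.card_sdiff_add_card_inter K W
    rw [Finset.inter_comm] at h2
    omega
  have hsum' : ∑ w ∈ W \ K, y w = ∑ k ∈ K \ W, y k := by
    have h1 := Finset.sum_inter_add_sum_sdiff W K y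
    have h2 := Finset.sum_inter_add_sum_sdiff K W y
    rw [Finset.inter_comm] at h2
    linarith
  have hWne : (W \ K).Nonempty := by
    rw [← Finset.card_pos, hcard']
    exact Finset.card_pos.2 ⟨m, hmD⟩
  obtain ⟨b, hb, hbmax⟩ := (W \ K).exists_max_image y hWne
  rw [Finset.mem_sdiff] at hb
  have hbm : y b < y m := (hy (hWm b hb.1)).lt_of_ne (hne b hb.1)
  have h1 : ∑ w ∈ W \ K, y w ≤ ∑ k ∈ K \ W, y b := by
    rw [Finset.sum_const, ← hcard']
    exact Finset.sum_le_card_nsmul _ _ _ hbmax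
  have h2 : ∑ k ∈ K \ W, y b < ∑ k ∈ K \ W, y k := by
    refine Finset.sum_lt_sum (fun k hk => hy ?_) ⟨m, hmD, hbm⟩
    by_contra! hbk
    exact hb.2 (hK k (Finset.mem_sdiff.1 hk).1 b (hWm b hb.1) hbk.le)
  linarith

open IsParentMap in
/-- A parent map whose children have the same number and `y`-sum as those of a breadth-first parent
map at vertices of equal value is conjugate to the breadth-first one. -/
theorem IsBFSParentMap.exists_conj {p q : Fin (n + 1) → Fin (n + 1)} (hq : IsBFSParentMap q)
    {y : Fin (n + 1) → ℝ} (hy : Antitone y)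
    (hch : ∀ v i, y v = y i → (v = 0 ↔ i = 0) →
      (children 0 p v).card = (children 0 q i).card ∧
      ∑ u ∈ children 0 p v, y u = ∑ u ∈ children 0 q i, y u) :
    ∃ σ : Equiv.Perm (Fin (n + 1)), σ 0 = 0 ∧ ∀ v, v ≠ 0 → σ (p v) = q (σ v) := by
  suffices H : ∀ m ≤ n + 1, ∃ σ : Equiv.Perm (Fin (n + 1)), σ 0 = 0 ∧ (∀ v, y (σ v) = y v) ∧
      ∀ v, v ≠ 0 → (σ v : ℕ) < m → σ (p v) = q (σ v) by
    obtain ⟨σ, h0, -, h⟩ := H (n + 1) le_rfl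
    exact ⟨σ, h0, fun v hv => h v hv (σ v).isLt⟩
  intro m
  induction m with
  | zero => exact fun _ => ⟨1, rfl, fun _ => rfl, fun _ _ h => absurd h (Nat.not_lt_zero _)⟩
  | succ m ih =>
    intro hm
    obtain ⟨σ, hσ0, hσy, hσ⟩ := ih (by omega)
    have hσne : ∀ v, v ≠ 0 ↔ σ v ≠ 0 := fun v => by
      rw [not_iff_not, ← hσ0, σ.apply_eq_iff_eq, hσ0]
    rcases Nat.eq_zero_or_pos m with rfl | hm0
    · refine ⟨σ, hσ0, hσy, fun v hv h => absurd (Fin.ext ?_) ((hσne v).1 hv)⟩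
      simpa using h
    set M : Fin (n + 1) := ⟨m, hm⟩ with hM
    have hM0 : M ≠ 0 := by
      intro h
      have := congrArg Fin.val h
      simp [hM] at this
      omega
    have hσlt : ∀ v, v ≠ 0 → σ v < M → σ (p v) = q (σ v) := fun v hv h => hσ v hv h
    set i := q M with hi
    have hiM : i < M := hq.lt M hM0
    set u := σ.symm i with hu
    have hσu : σ u = i := σ.apply_symm_apply i
    obtain ⟨hc, hs⟩ := hch u i (by rw [← hσu, hσy]) (by rw [← not_iff_not, ← hσu]; exact hσne u)
    have hused : ((children 0 p u).filter fun w => σ w < M).map σ.toEmbedding =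
        (children 0 q i).filter fun k => k < M := by
      ext k
      obtain ⟨w, rfl⟩ := σ.surjective k
      simp only [Finset.mem_map_equiv, Equiv.symm_apply_apply, Finset.mem_filter, mem_children]
      refine and_congr_left fun hw => ?_
      rw [← hσne w]
      refine and_congr_right fun hw0 => ?_
      rw [← hσlt w hw0 hw, ← hσu, σ.apply_eq_iff_eq]
    set W := ((children 0 p u).filter fun w => ¬ σ w < M).map σ.toEmbedding with hW
    set K := (children 0 q i).filter fun k => ¬ k < M with hK
    have hcard : W.card = K.card := by
      have h1 := Finset.card_filter_add_card_filter_not (s := children 0 p u) fun w => σ w < M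
      have h2 := Finset.card_filter_add_card_filter_not (s := children 0 q i) fun k => k < M
      rw [← hused, Finset.card_map] at h2
      rw [hW, hK, Finset.card_map]
      omega
    have hsum : ∑ w ∈ W, y w = ∑ k ∈ K, y k := by
      have h1 := Finset.sum_filter_add_sum_filter_not (children 0 p u) (fun w => σ w < M) y
      have h2 := Finset.sum_filter_add_sum_filter_not (children 0 q i) (fun k => k < M) y
      rw [← hused, Finset.sum_map] at h2
      rw [hW, hK, Finset.sum_map]
      simp only [Equiv.coe_toEmbedding, hσy] at h2 ⊢
      linarith
    have hmemK : ∀ k, k ∈ K ↔ (k ≠ 0 ∧ q k = i) ∧ M ≤ k := by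
      intro k
      rw [hK, Finset.mem_filter, mem_children, not_lt]
    obtain ⟨w', hw', hyw⟩ := hy.exists_eq_of_sum_eq (K := K) (W := W) (m := M)
      ((hmemK M).2 ⟨⟨hM0, rfl⟩, le_rfl⟩)
      (fun k hk j hMj hjk => by
        rw [hmemK] at hk ⊢
        have hj0 : j ≠ 0 := by
          rintro rfl
          exact hM0 (le_antisymm hMj (Fin.zero_le _))
        refine ⟨⟨hj0, le_antisymm ?_ (hq.mono M j hM0 hMj)⟩, hMj⟩
        rw [← hk.1.2]
        exact hq.mono j k hj0 hjk)
      (fun w hw => by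
        obtain ⟨w, hmem, rfl⟩ := Finset.mem_map.1 hw
        exact not_lt.1 (Finset.mem_filter.1 hmem).2)
      hcard hsum
    obtain ⟨w, hw, rfl⟩ := Finset.mem_map.1 hw'
    rw [Finset.mem_filter, mem_children, not_lt] at hw
    obtain ⟨⟨hw0, hpw⟩, hMw⟩ := hw
    simp only [Equiv.coe_toEmbedding] at hyw hw'
    have hfix : ∀ k, k < M → Equiv.swap (σ w) M k = k := fun k hk =>
      Equiv.swap_apply_of_ne_of_ne (hk.trans_le hMw).ne hk.ne
    refine ⟨σ.trans (Equiv.swap (σ w) M), ?_, fun v => ?_, fun v hv hvm => ?_⟩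
    · rw [Equiv.trans_apply, hσ0]
      exact hfix 0 (Fin.pos_iff_ne_zero.2 hM0)
    · rw [Equiv.trans_apply, ← hσy v, Equiv.swap_apply_def]
      split_ifs with h1 h2
      · rw [h1, hyw]
      · rw [h2, hyw]
      · rfl
    · rw [Equiv.trans_apply] at hvm ⊢
      rw [Equiv.trans_apply]
      by_cases hvw : v = w
      · subst hvw
        rw [Equiv.swap_apply_left, hpw, hσu]
        exact hfix i hiM
      · have hlt : Equiv.swap (σ w) M (σ v) < M := by
          refine lt_of_le_of_ne (Nat.lt_succ_iff.1 hvm) fun h => hvw ?_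
          rw [Equiv.swap_apply_eq_iff, Equiv.swap_apply_right] at h
          exact σ.injective h
        have hσv : σ v < M := by
          by_contra! hge
          rw [Equiv.swap_apply_def] at hlt
          split_ifs at hlt with h1 h2
          · exact lt_irrefl _ hlt
          · exact absurd hlt (not_lt.2 hMw)
          · exact absurd hlt (not_lt.2 hge)
        rw [hfix _ hσv, hσlt v hv hσv]
        exact hfix _ ((hq.lt _ ((hσne v).1 hv)).trans hσv)

end

theorem IsTreeDegreeSequence.sum_eq_and_pos {n : ℕ} {d : Fin (n + 1) → ℕ}
    (h : IsTreeDegreeSequence d) : ∑ i, d i = 2 * n ∧ (1 ≤ n → ∀ i, 1 ≤ d i) := by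
  obtain ⟨G, _, hG, e, he⟩ := h
  constructor
  · have h1 := G.sum_degrees_eq_twice_card_edges
    have h2 := hG.card_edgeFinset
    rw [Fintype.card_fin] at h2
    rw [← Equiv.sum_comp e, ← Finset.sum_congr rfl fun v _ => he v, h1]
    omega
  · intro hn i
    have : Nontrivial (Fin (n + 1)) := Fin.nontrivial_iff_two_le.2 (by omega)
    have h1 := hG.connected.preconnected.degree_pos_of_nontrivial (e.symm i)
    rw [he, e.apply_symm_apply] at h1
    exact h1

open Matrix in
theorem aAlphaMatrix_mulVec_comp_iso {V W : Type*} [Fintype V] [DecidableEq V] [Fintype W]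
    [DecidableEq W] (α : ℝ) {G : SimpleGraph V} [DecidableRel G.Adj] {H : SimpleGraph W}
    [DecidableRel H.Adj] (e : G ≃g H) (x : W → ℝ) (v : V) :
    (aAlphaMatrix α G *ᵥ (x ∘ e)) v = (aAlphaMatrix α H *ᵥ x) (e v) := by
  rw [aAlphaMatrix_mulVec, aAlphaMatrix_mulVec, e.degree_eq]
  congr 2
  refine Finset.sum_bij (fun u _ => e u) (fun u hu => ?_) (fun _ _ _ _ h => e.injective h)
    (fun u hu => ⟨e.symm u, ?_, e.apply_symm_apply u⟩) fun _ _ => rfl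
  · rw [SimpleGraph.mem_neighborFinset] at hu ⊢
    exact e.map_adj_iff.2 hu
  · rw [SimpleGraph.mem_neighborFinset] at hu ⊢
    rw [← e.map_adj_iff, e.apply_symm_apply]
    exact hu

theorem sum_le_sum_of_antitone_comp_perm {n : ℕ} {d : Fin (n + 1) → ℕ} (hd : Antitone d)
    (τ : Equiv.Perm (Fin (n + 1))) {f : Fin (n + 1) → ℝ} (hf : Antitone f) :
    ∑ i, (d (τ i) : ℝ) * f i ≤ ∑ i, (d i : ℝ) * f i :=
  Monovary.sum_comp_perm_mul_le_sum_mul (f := fun i => (d i : ℝ)) (σ := τ)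
    (Antitone.monovary (fun _ _ h => Nat.cast_le.2 (hd h)) hf)

open IsParentMap in
theorem IsParentMap.sum_parent_add_sum {n : ℕ} {G : SimpleGraph (Fin (n + 1))}
    [DecidableRel G.Adj] {p : Fin (n + 1) → Fin (n + 1)} (h : IsParentMap G 0 p)
    (f : Fin (n + 1) → ℝ) :
    ∑ k ∈ Finset.univ.erase 0, f (p k) + ∑ i ∈ Finset.univ.erase 0, f i =
      ∑ i, (G.degree i : ℝ) * f i := by
  rw [← sum_sum_children (fun v _ => f v), ← Finset.add_sum_erase _ _ (Finset.mem_univ 0),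
    ← Finset.add_sum_erase _ (fun i => (G.degree i : ℝ) * f i) (Finset.mem_univ 0),
    add_assoc, ← Finset.sum_add_distrib, h.degree_root, Finset.sum_const, nsmul_eq_mul]
  congr 1
  refine Finset.sum_congr rfl fun i hi => ?_
  rw [h.degree_eq (Finset.ne_of_mem_erase hi), Finset.sum_const, nsmul_eq_mul]
  push_cast
  ring

open IsParentMap in
theorem IsParentMap.card_parent_le_mono {n : ℕ} {G H : SimpleGraph (Fin (n + 1))}
    [DecidableRel G.Adj] [DecidableRel H.Adj] {p q : Fin (n + 1) → Fin (n + 1)}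
    (hG : IsParentMap G 0 p) (hH : IsParentMap H 0 q) (hd : Antitone fun i => H.degree i)
    (τ : Equiv.Perm (Fin (n + 1))) (hτ : ∀ i, G.degree i = H.degree (τ i)) (t : Fin (n + 1)) :
    ((Finset.univ.erase 0).filter fun k => p k ≤ t).card ≤
      ((Finset.univ.erase 0).filter fun k => q k ≤ t).card := by
  set f : Fin (n + 1) → ℝ := fun i => if i ≤ t then 1 else 0 with hf
  have h1 := hG.sum_parent_add_sum f
  have h2 := hH.sum_parent_add_sum f
  have h3 := sum_le_sum_of_antitone_comp_perm hd τ (f := f) (by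
    intro i j hij
    simp only [hf]
    split_ifs with h h'
    · exact le_rfl
    · exact absurd (hij.trans h) h'
    · exact zero_le_one
    · exact le_rfl)
  simp_rw [← hτ] at h3
  have h4 : ∑ k ∈ Finset.univ.erase 0, f (p k) ≤ ∑ k ∈ Finset.univ.erase 0, f (q k) := by linarith
  simp only [hf, Finset.sum_boole] at h4
  exact_mod_cast h4

/-- If two rooted graphs have the same degrees up to a permutation, and corresponding parents have
equal degrees in the second one, then corresponding degrees agree. -/
theorem IsParentMap.degree_eq_of_parent {n : ℕ} {G H : SimpleGraph (Fin (n + 1))}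
    [DecidableRel G.Adj] [DecidableRel H.Adj] {p q : Fin (n + 1) → Fin (n + 1)}
    (hG : IsParentMap G 0 p) (hH : IsParentMap H 0 q)
    (τ : Equiv.Perm (Fin (n + 1))) (hτ : ∀ i, G.degree i = H.degree (τ i))
    (hpq : ∀ k, k ≠ 0 → H.degree (p k) = H.degree (q k)) (i : Fin (n + 1)) :
    G.degree i = H.degree i := by
  set f : Fin (n + 1) → ℝ := fun i => H.degree i with hf
  have h1 := hG.sum_parent_add_sum f
  have h2 := hH.sum_parent_add_sum f
  have h3 : ∑ k ∈ Finset.univ.erase 0, f (p k) = ∑ k ∈ Finset.univ.erase 0, f (q k) :=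
    Finset.sum_congr rfl fun k hk => by simp only [hf, hpq k (Finset.ne_of_mem_erase hk)]
  have h4 : ∑ i, (G.degree i : ℝ) ^ 2 = ∑ i, f i ^ 2 := by
    simp_rw [hτ]
    exact Equiv.sum_comp τ fun i => f i ^ 2
  have h5 : ∑ i, ((G.degree i : ℝ) - f i) ^ 2 = 0 := by
    have h6 : ∀ i, ((G.degree i : ℝ) - f i) ^ 2 =
        (G.degree i : ℝ) ^ 2 + f i ^ 2 - 2 * (G.degree i * f i) := fun i => by ring
    have h7 : ∀ i, (H.degree i : ℝ) * f i = f i ^ 2 := fun i => (sq _).symm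
    simp_rw [h7] at h2
    simp_rw [h6, Finset.sum_sub_distrib, Finset.sum_add_distrib, ← Finset.mul_sum]
    linarith
  have h6 := (Finset.sum_eq_zero_iff_of_nonneg fun i _ => sq_nonneg _).1 h5 i (Finset.mem_univ i)
  have h7 := sub_eq_zero.1 (pow_eq_zero_iff two_ne_zero |>.1 h6)
  simp only [hf] at h7
  exact_mod_cast h7

theorem IsParentMap.iso_of_conj {n : ℕ} {G H : SimpleGraph (Fin (n + 1))}
    {p q : Fin (n + 1) → Fin (n + 1)} (hG : IsParentMap G 0 p) (hH : IsParentMap H 0 q)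
    (σ : Equiv.Perm (Fin (n + 1))) (h0 : σ 0 = 0) (h : ∀ v, v ≠ 0 → σ (p v) = q (σ v)) :
    Nonempty (G ≃g H) := by
  have hne : ∀ v, σ v ≠ 0 ↔ v ≠ 0 := fun v => by
    rw [not_iff_not, ← h0, σ.apply_eq_iff_eq, h0]
  refine ⟨⟨σ, fun {u v} => ?_⟩⟩
  rw [hG.adj_iff, hH.adj_iff, hne, hne]
  refine or_congr (and_congr_right fun hu => ?_) (and_congr_right fun hv => ?_)
  · rw [← h u hu, σ.apply_eq_iff_eq]
  · rw [← h v hv, σ.apply_eq_iff_eq]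

section core

variable {n : ℕ} {G H : SimpleGraph (Fin (n + 1))} [DecidableRel G.Adj] [DecidableRel H.Adj]
  {p q : Fin (n + 1) → Fin (n + 1)} {α : ℝ} {y : Fin (n + 1) → ℝ}

open Matrix in
theorem IsParentMap.quadraticForm_le (hG : IsParentMap G 0 p) (hH : IsParentMap H 0 q)
    (hq : IsBFSParentMap q) (hd : Antitone fun i => H.degree i) (τ : Equiv.Perm (Fin (n + 1)))
    (hτ : ∀ i, G.degree i = H.degree (τ i)) (h0 : 0 ≤ α) (h1 : α < 1) (hy : Antitone y)
    (hpos : ∀ i, 0 < y i) :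
    y ⬝ᵥ aAlphaMatrix α G *ᵥ y ≤ y ⬝ᵥ aAlphaMatrix α H *ᵥ y ∧
    (y ⬝ᵥ aAlphaMatrix α G *ᵥ y = y ⬝ᵥ aAlphaMatrix α H *ᵥ y →
      ∑ k ∈ Finset.univ.erase 0, y k * y (p k) = ∑ k ∈ Finset.univ.erase 0, y k * y (q k)) := by
  rw [hG.dotProduct_aAlphaMatrix, hH.dotProduct_aAlphaMatrix]
  have hdeg := sum_le_sum_of_antitone_comp_perm hd τ (f := fun i => y i ^ 2)
    fun i j hij => pow_le_pow_left₀ (hpos j).le (hy hij) 2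
  simp_rw [← hτ] at hdeg
  have hα : 0 < 1 - α := by linarith
  have hdeg' := mul_le_mul_of_nonneg_left hdeg h0
  have hedge := sum_mul_parent_le (p := p) hy hpos hq (hG.card_parent_le_mono hH hd τ hτ)
  have hedge' := mul_le_mul_of_nonneg_left hedge hα.le
  refine ⟨by linarith, fun h => le_antisymm hedge ?_⟩
  refine le_of_mul_le_mul_left ?_ hα
  linarith

open Matrix IsParentMap in
theorem IsParentMap.nonempty_iso (hG : IsParentMap G 0 p) (hH : IsParentMap H 0 q)
    (hq : IsBFSParentMap q) (hd : Antitone fun i => H.degree i) (τ : Equiv.Perm (Fin (n + 1)))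
    (hτ : ∀ i, G.degree i = H.degree (τ i)) (h0 : 0 ≤ α) (h1 : α < 1) (hy : Antitone y)
    (hpos : ∀ i, 0 < y i) {ρ : ℝ} (hyG : aAlphaMatrix α G *ᵥ y = ρ • y)
    (hyH : aAlphaMatrix α H *ᵥ y = ρ • y) : Nonempty (G ≃g H) := by
  have hcls : ∀ i j, y i = y j →
      H.degree i = H.degree j ∧ (i ≠ 0 → j ≠ 0 → y (q i) = y (q j)) := by
    intro i j hij
    rcases lt_trichotomy i j with h | rfl | h
    · obtain ⟨h2, h3⟩ := hH.degree_eq_and_parent_eq hq hd h0 h1 hy hpos hyH h hij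
      exact ⟨h2, fun hi _ => h3 hi⟩
    · exact ⟨rfl, fun _ _ => rfl⟩
    · obtain ⟨h2, h3⟩ := hH.degree_eq_and_parent_eq hq hd h0 h1 hy hpos hyH h hij.symm
      exact ⟨h2.symm, fun _ hj => (h3 hj).symm⟩
  have hsum := (hG.quadraticForm_le hH hq hd τ hτ h0 h1 hy hpos).2 (by rw [hyG, hyH])
  have hpar : ∀ k, k ≠ 0 → y (p k) = y (q k) := fun k hk =>
    parent_value_eq_of_sum_eq hy hpos hq (hG.card_parent_le_mono hH hd τ hτ)
      (fun i j hi hj hij => (hcls i j hij).2 hi hj) hsum hk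
  have hdeg := hG.degree_eq_of_parent hH τ hτ fun k hk => (hcls _ _ (hpar k hk)).1
  obtain ⟨σ, hσ0, hσ⟩ := hq.exists_conj (p := p) hy fun v i hvi hv0 => by
    have hdvi : G.degree v = H.degree i := (hdeg v).trans (hcls v i hvi).1
    have hnb : ∑ u ∈ G.neighborFinset v, y u = ∑ u ∈ H.neighborFinset i, y u := by
      have e1 := congrFun hyG v
      have e2 := congrFun hyH i
      rw [aAlphaMatrix_mulVec, Pi.smul_apply, smul_eq_mul, hdvi, hvi] at e1
      rw [aAlphaMatrix_mulVec, Pi.smul_apply, smul_eq_mul] at e2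
      exact mul_left_cancel₀ (sub_pos.2 h1).ne' (by linarith)
    by_cases hv : v = 0
    · have hi := hv0.1 hv
      subst hv hi
      rw [hG.sum_neighborFinset_root, hH.sum_neighborFinset_root] at hnb
      rw [hG.degree_root, hH.degree_root] at hdvi
      exact ⟨hdvi, hnb⟩
    · have hi : i ≠ 0 := fun h => hv (hv0.2 h)
      rw [hG.sum_neighborFinset y hv, hH.sum_neighborFinset y hi, hpar v hv,
        (hcls v i hvi).2 hv hi] at hnb
      rw [hG.degree_eq hv, hH.degree_eq hi] at hdvi
      exact ⟨by omega, by linarith⟩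
  exact hG.iso_of_conj hH σ hσ0 hσ

end core

/-- The vertices of a finite set can be numbered so that a given function is nonincreasing. -/
theorem exists_equiv_antitone {V : Type*} {m : ℕ} (e : V ≃ Fin m) (x : V → ℝ) :
    ∃ σ : Fin m ≃ V, Antitone (x ∘ σ) := by
  refine ⟨(Tuple.sort fun i => -x (e.symm i)).trans e.symm, fun i j hij => ?_⟩
  have := Tuple.monotone_sort (fun i => -x (e.symm i)) hij
  simpa using this

theorem theorem1p1 {n : ℕ} (d : Fin n → ℕ) (hmono : Antitone d) (htree : IsTreeDegreeSequence d)
    (α : ℝ) (hα0 : 0 ≤ α) (hα1 : α < 1) :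
    ((bfsTree d).IsTree ∧ HasDegreeSequence (bfsTree d) d) ∧
    ∀ {V : Type*} [Fintype V] [DecidableEq V] (G : SimpleGraph V) [DecidableRel G.Adj],
      G.IsTree → HasDegreeSequence G d →
        aAlphaSpectralRadius α G ≤ aAlphaSpectralRadius α (bfsTree d) ∧
        (aAlphaSpectralRadius α G = aAlphaSpectralRadius α (bfsTree d) ↔
          Nonempty (G ≃g bfsTree d)) := by
  obtain _ | n := n
  · obtain ⟨G, _, hG, _⟩ := htree
    exact hG.connected.nonempty.some.elim0
  obtain ⟨hsum, hpos⟩ := htree.sum_eq_and_pos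
  obtain ⟨q, hH, hq, hdeg⟩ := exists_bfsTree_isParentMap hmono hsum hpos
  have hHtree := hH.isTree hq
  have hd : Antitone fun i => (bfsTree d).degree i := fun i j hij => by
    simpa only [hdeg] using hmono hij
  refine ⟨⟨hHtree, Equiv.refl _, hdeg⟩, fun {V} _ _ G _ hG hGd => ?_⟩
  obtain ⟨e, he⟩ := hGd
  obtain ⟨ρ, x, hρ, hGρ, hx, hxe, -, -⟩ := hG.connected.exists_perron hα0 hα1
  obtain ⟨ρ', -, hρ', hHρ', -, -, hmax, heq⟩ := hHtree.connected.exists_perron hα0 hα1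
  obtain ⟨σ, hσ⟩ := exists_equiv_antitone e x
  let f : G.comap σ ≃g G := SimpleGraph.Iso.comap σ G
  have hye : (aAlphaMatrix α (G.comap σ)).mulVec (x ∘ σ) = ρ • (x ∘ σ) := by
    funext i
    have := aAlphaMatrix_mulVec_comp_iso α f x i
    rw [hxe] at this
    exact this
  obtain ⟨p, hp⟩ := (f.isTree_iff.2 hG).exists_isParentMap 0
  have hτ : ∀ i, (G.comap σ).degree i = (bfsTree d).degree ((σ.trans e) i) := by
    intro i
    rw [hdeg, ← f.degree_eq i]
    exact he (σ i)
  have hle := (hp.quadraticForm_le hH hq hd _ hτ hα0 hα1 hσ fun i => hx (σ i)).1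
  have hmax' := hmax (x ∘ σ)
  rw [hye, dotProduct_smul, smul_eq_mul] at hle
  have hyy : 0 < (x ∘ σ) ⬝ᵥ (x ∘ σ) :=
    Finset.sum_pos (fun i _ => mul_pos (hx (σ i)) (hx (σ i))) ⟨0, Finset.mem_univ 0⟩
  rw [hGρ, hHρ']
  refine ⟨ENNReal.ofReal_le_ofReal (le_of_mul_le_mul_right (hle.trans hmax') hyy), fun h => ?_,
    fun ⟨g⟩ => ?_⟩
  · rw [ENNReal.ofReal_eq_ofReal_iff hρ hρ'] at h
    have hyH := heq (x ∘ σ) (le_antisymm hmax' (h ▸ hle))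
    rw [← h] at hyH
    obtain ⟨g⟩ := hp.nonempty_iso hH hq hd _ hτ hα0 hα1 hσ (fun i => hx (σ i)) hye hyH
    exact ⟨f.symm.trans g⟩
  · rw [← hGρ, ← hHρ']
    exact aAlphaSpectralRadius_eq_of_iso α g
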